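/- For $\lambda\in(0,\tfrac12)$ and $x\in\mathbb R$ let $$\varphi_\lambda(x)=\int_0^{\infty}y^{-2\lambda}\exp\Big(-\frac{(y-x)^2}{2}\Big)\,dy .$$ Then for every $\lambda\in(0,\tfrac12)$ there are a unique $x_1^\lambda<0$ with $\varphi_\lambda''(x_1^\lambda)=0$ and a unique $z^\lambda>0$ with $\varphi_\lambda''(z^\lambda)+\varphi_\lambda''(-z^\lambda)=0$. Put $\sigma_\lambda:=-x_1^\lambda/z^\lambda$. Let $\sigma\in(0,1)$ be fixed. There is a unique $\lambda_\sigma\in(0,\tfrac12)$ with $\sigma_{\lambda_\sigma}=\sigma$. For $\lambda\in(0,\lambda_\sigma]$, with $w:=\sigma z^\lambda$, let $$\mu_1=\frac{\varphi_\lambda''(w)\,[\varphi_\lambda(-z^\lambda)+\varphi_\lambda(z^\lambda)]}{\varphi_\lambda(-w)\varphi_\lambda''(w)-\varphi_\lambda(w)\varphi_\lambda''(-w)},\qquad \mu_2=\frac{\varphi_\lambda''(-w)\,[\varphi_\lambda(-z^\lambda)+\varphi_\lambda(z^\lambda)]}{\varphi_\lambda(w)\varphi_\lambda''(-w)-\varphi_\lambda(-w)\varphi_\lambda''(w)},$$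 $$H_{\lambda,\sigma}(x)=\begin{cases}\mu_1\varphi_\lambda(x)+\mu_2\varphi_\lambda(-x), & x\le-\sigma z^\lambda,\\ \varphi_\lambda(x/\sigma)+\varphi_\lambda(-x/\sigma), & -\sigma z^\lambda<x<\sigma z^\lambda,\\ \mu_2\varphi_\lambda(x)+\mu_1\varphi_\lambda(-x), & x\ge\sigma z^\lambda.\end{cases}$$ Then for every $\lambda\in(0,\lambda_\sigma]$ one has $\mu_1>0$, $\mu_2\ge0$, and $H_{\lambda,\sigma}$ is a positive $C^2$ function on $\mathbb R$ which satisfies, for all $x\in\mathbb R$, $$(y'')^+-\sigma^2(y'')^-+xy'+2\lambda y=0,\qquad a^+=\max(a,0),\ a^-=\max(-a,0).$$ -/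

import Mathlib

namespace GHeat

/-- `φ_l(x) = ∫_0^∞ y^{-2l} exp(-(y-x)²/2) dy`. -/
noncomputable def phi (l x : ℝ) : ℝ :=
  ∫ y in Set.Ioi (0 : ℝ), y ^ (-2 * l) * Real.exp (-(y - x) ^ 2 / 2)

/-- The second derivative `φ_l''(x)`. -/
noncomputable def phi'' (l x : ℝ) : ℝ :=
  deriv (deriv (phi l)) x

/-- `x` is a negative zero of `φ_l''`. -/
def IsX1 (l x : ℝ) : Prop :=
  x < 0 ∧ phi'' l x = 0

/-- `z` is a positive zero of `x ↦ φ_l''(x) + φ_l''(-x)`. -/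
def IsZ (l z : ℝ) : Prop :=
  0 < z ∧ phi'' l z + phi'' l (-z) = 0

/-- The constant `x₁^l`: the negative zero of `φ_l''`. -/
noncomputable def x1 (l : ℝ) : ℝ :=
  Classical.epsilon (IsX1 l)

/-- The constant `z^l`: the positive zero of `x ↦ φ_l''(x) + φ_l''(-x)`. -/
noncomputable def zeta (l : ℝ) : ℝ :=
  Classical.epsilon (IsZ l)

/-- `σ_l = -x₁^l / z^l`. -/
noncomputable def sigmaOf (l : ℝ) : ℝ :=
  -x1 l / zeta l

/-- `l ∈ (0, 1/2)` and `σ_l = σ`. -/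
def IsLambda (σ l : ℝ) : Prop :=
  l ∈ Set.Ioo (0 : ℝ) (1 / 2) ∧ sigmaOf l = σ

/-- The constant `λ_σ ∈ (0, 1/2)`, determined by `σ_{λ_σ} = σ`. -/
noncomputable def lambdaOf (σ : ℝ) : ℝ :=
  Classical.epsilon (IsLambda σ)

/-- The coefficient `μ₁`. -/
noncomputable def mu1 (l σ : ℝ) : ℝ :=
  phi'' l (σ * zeta l) *
    (phi l (-(σ * zeta l)) * phi'' l (σ * zeta l) -
      phi l (σ * zeta l) * phi'' l (-(σ * zeta l)))⁻¹ *
    (phi l (-zeta l) + phi l (zeta l))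

/-- The coefficient `μ₂`. -/
noncomputable def mu2 (l σ : ℝ) : ℝ :=
  phi'' l (-(σ * zeta l)) *
    (phi l (σ * zeta l) * phi'' l (-(σ * zeta l)) -
      phi l (-(σ * zeta l)) * phi'' l (σ * zeta l))⁻¹ *
    (phi l (-zeta l) + phi l (zeta l))

/-- The piecewise function `H_{l,σ}`. -/
noncomputable def H (l σ x : ℝ) : ℝ :=
  if x ≤ -(σ * zeta l) then mu1 l σ * phi l x + mu2 l σ * phi l (-x)
  else if x < σ * zeta l then phi l (x / σ) + phi l (-(x / σ))
  else mu2 l σ * phi l x + mu1 l σ * phi l (-x)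

/-- `y` is a `C²` solution on `ℝ` of `(y'')⁺ - σ² (y'')⁻ + x y' + 2 l y = 0`, where
`a⁺ = max a 0` and `a⁻ = max (-a) 0`. -/
def IsC2Solution (l σ : ℝ) (y : ℝ → ℝ) : Prop :=
  ContDiff ℝ 2 y ∧
    ∀ x : ℝ, max (deriv (deriv y) x) 0 - σ ^ 2 * max (-deriv (deriv y) x) 0 +
      x * deriv y x + 2 * l * y x = 0

end GHeat

/-!
The substitution `a = 2 l` turns `phi l` into a positive solution on `ℝ` of the linear equation
`y'' + x y' + a y = 0` (differentiation under the integral and one integration by parts, in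
`isSol_phi`); its reflection `x ↦ phi l (-x)` is another one.

**Zeros of the second derivative.** For a solution `y` that is positive on `(0, ∞)`, the function
`t^{-(1+a)} exp(t²/2) y''(t)` is strictly increasing there (`IsSol.strictMonoOn_curv_mul`). Hence
`y''` has at most one zero on `(0, ∞)` and passes there from negative to positive. Applied to the
reflection of `phi l` this gives `x1 l`, applied to the even solution `phi l x + phi l (-x)` it
gives `zeta l`.

**The map `l ↦ sigmaOf l`.** It is a strictly increasing bijection from `(0, 1/2)` to `(0, 1)`:
* `-x1 l` increases with `l`, because the condition `phi''(-t) = 0` reads `t m + t² = a` with `m` the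
  mean of the weight `y^{-a} exp(-(y+t)²/2)`, and this mean decreases in `a`
  (`moment_mul_moment_le`);
* `zeta l` decreases with `l`, by comparing the Riccati equations `Q' = 1 - t Q + a Q²`, `Q(0) = 0`,
  satisfied by `Q = -u' / (a u)` for the even solution `u` (`IsSol.curv_pos_of_param_lt`);
* both zeros are continuous in `l`, since they are sign changes of functions continuous in `l`;
* `-x1 l ≤ √(2 l)` tends to `0` as `l → 0`, while `-x1 l` and `zeta l` tend to `1` as `l → 1/2`.

**The function `H`.** For `l ≤ lambdaOf σ` monotonicity gives `-x1 l ≤ w < zeta l` with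
`w = σ * zeta l`, so `phi''(-w) ≥ 0` and `phi''(w) < 0`, which yields the signs of `mu1` and `mu2`.
These coefficients are chosen so that at `±w` the pieces of `H` agree in value and all have
vanishing second derivative; since each piece solves its own linear equation, the first
derivatives agree as well. The middle piece is concave, and the outer pieces, being positive
solutions whose second derivative vanishes at `±w`, are convex beyond `±w`; hence the pieces solve
the nonlinear equation.
-/

namespace GHeat

open MeasureTheory Filter Topology

/-! ### Shifted Gaussian moments on the half-line -/

/-- The moment `∫_0^∞ y^s exp(-(y-x)²/2) dy`, a convergent integral for `-1 < s`. -/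
noncomputable def moment (s x : ℝ) : ℝ :=
  ∫ y in Set.Ioi (0 : ℝ), y ^ s * Real.exp (-(y - x) ^ 2 / 2)

lemma phi_eq_moment (l x : ℝ) : phi l x = moment (-2 * l) x := rfl

lemma exp_shift_le {x R : ℝ} (hx : |x| ≤ R) (y : ℝ) :
    Real.exp (-(y - x) ^ 2 / 2) ≤ Real.exp (R ^ 2 / 2) * Real.exp (-(1 / 4) * y ^ 2) := by
  rw [← Real.exp_add]
  apply Real.exp_le_exp.2
  have h : x ^ 2 ≤ R ^ 2 := by
    rw [← sq_abs x]; exact pow_le_pow_left₀ (abs_nonneg x) hx 2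
  nlinarith [sq_nonneg (y - 2 * x)]

lemma aestronglyMeasurable_rpow_mul_exp (s x : ℝ) :
    AEStronglyMeasurable (fun y : ℝ => y ^ s * Real.exp (-(y - x) ^ 2 / 2))
      (volume.restrict (Set.Ioi 0)) := by
  refine ContinuousOn.aestronglyMeasurable ?_ measurableSet_Ioi
  refine ContinuousOn.mul ?_ (by fun_prop)
  exact fun y hy => (Real.continuousAt_rpow_const y s (Or.inl (ne_of_gt hy))).continuousWithinAt

lemma integrableOn_rpow_mul_exp {s : ℝ} (hs : -1 < s) (x : ℝ) :
    IntegrableOn (fun y : ℝ => y ^ s * Real.exp (-(y - x) ^ 2 / 2)) (Set.Ioi 0) := by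
  have h := (integrableOn_rpow_mul_exp_neg_mul_sq (b := 1 / 4) (by norm_num) hs).const_mul
    (Real.exp (|x| ^ 2 / 2))
  refine Integrable.mono' h (aestronglyMeasurable_rpow_mul_exp s x) ?_
  refine (ae_restrict_mem measurableSet_Ioi).mono fun y hy => ?_
  have hy' : 0 < y := hy
  have h0 : 0 ≤ y ^ s := Real.rpow_nonneg hy'.le s
  rw [Real.norm_of_nonneg (mul_nonneg h0 (Real.exp_pos _).le)]
  calc y ^ s * Real.exp (-(y - x) ^ 2 / 2)
      ≤ y ^ s * (Real.exp (|x| ^ 2 / 2) * Real.exp (-(1 / 4) * y ^ 2)) :=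
        mul_le_mul_of_nonneg_left (exp_shift_le le_rfl y) h0
    _ = _ := by ring

lemma moment_pos {s : ℝ} (hs : -1 < s) (x : ℝ) : 0 < moment s x := by
  have hpos : ∀ y ∈ Set.Ioi (0 : ℝ), 0 < y ^ s * Real.exp (-(y - x) ^ 2 / 2) := fun y hy =>
    mul_pos (Real.rpow_pos_of_pos hy s) (Real.exp_pos _)
  unfold moment
  rw [setIntegral_pos_iff_support_of_nonneg_ae _ (integrableOn_rpow_mul_exp hs x)]
  · have : Set.Ioi (0 : ℝ) ⊆ Function.support
        (fun y : ℝ => y ^ s * Real.exp (-(y - x) ^ 2 / 2)) ∩ Set.Ioi 0 :=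
      fun y hy => ⟨(hpos y hy).ne', hy⟩
    exact lt_of_lt_of_le (by simp) (measure_mono this)
  · exact (ae_restrict_mem measurableSet_Ioi).mono fun y hy => (hpos y hy).le

lemma hasDerivAt_moment {s : ℝ} (hs : -1 < s) (x : ℝ) :
    HasDerivAt (moment s) (moment (s + 1) x - x * moment s x) x := by
  have hi := integrableOn_rpow_mul_exp hs
  have hi1 := integrableOn_rpow_mul_exp (s := s + 1) (by linarith)
  have hsplit : ∀ z, ∀ y ∈ Set.Ioi (0 : ℝ), y ^ s * (Real.exp (-(y - z) ^ 2 / 2) * (y - z)) =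
      y ^ (s + 1) * Real.exp (-(y - z) ^ 2 / 2) - z * (y ^ s * Real.exp (-(y - z) ^ 2 / 2)) := by
    intro z y hy
    rw [Real.rpow_add_one (ne_of_gt hy)]; ring
  set R : ℝ := |x| + 1 with hR
  have key := (hasDerivAt_integral_of_dominated_loc_of_deriv_le
    (μ := volume.restrict (Set.Ioi (0 : ℝ)))
    (F := fun z y : ℝ => y ^ s * Real.exp (-(y - z) ^ 2 / 2))
    (F' := fun z y : ℝ => y ^ s * (Real.exp (-(y - z) ^ 2 / 2) * (y - z)))
    (x₀ := x) (s := Metric.ball x 1)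
    (bound := fun y => Real.exp (R ^ 2 / 2) * (y ^ (s + 1) * Real.exp (-(1 / 4) * y ^ 2)) +
      R * Real.exp (R ^ 2 / 2) * (y ^ s * Real.exp (-(1 / 4) * y ^ 2)))
    (Metric.ball_mem_nhds x one_pos)
    (Filter.Eventually.of_forall fun z => aestronglyMeasurable_rpow_mul_exp s z)
    (hi x) ?_ ?_ ?_ ?_).2
  · refine key.congr_deriv ?_
    rw [setIntegral_congr_fun measurableSet_Ioi (hsplit x), integral_sub (hi1 x)
      ((hi x).const_mul x), integral_const_mul]
    rfl
  · have h := (aestronglyMeasurable_rpow_mul_exp (s + 1) x).sub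
      ((aestronglyMeasurable_rpow_mul_exp s x).const_mul x)
    refine h.congr ((ae_restrict_mem measurableSet_Ioi).mono fun y hy => ?_)
    exact (hsplit x y hy).symm
  · refine (ae_restrict_mem measurableSet_Ioi).mono fun y hy z hz => ?_
    have hy' : 0 < y := hy
    have h0 : 0 < y ^ s := Real.rpow_pos_of_pos hy' s
    have hz' : |z| ≤ R := by
      have h1 : |z - x| < 1 := by simpa [Real.dist_eq] using hz
      have h2 := abs_add_le (z - x) x
      rw [sub_add_cancel] at h2
      linarith
    have hyz : |y - z| ≤ y + R := by
      have := abs_sub y z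
      rw [abs_of_pos hy'] at this
      linarith
    rw [norm_mul, norm_mul, Real.norm_of_nonneg h0.le, Real.norm_of_nonneg (Real.exp_pos _).le,
      Real.norm_eq_abs]
    calc y ^ s * (Real.exp (-(y - z) ^ 2 / 2) * |y - z|)
        ≤ y ^ s * ((Real.exp (R ^ 2 / 2) * Real.exp (-(1 / 4) * y ^ 2)) * (y + R)) := by
          have := exp_shift_le hz' y
          gcongr
      _ = _ := by rw [Real.rpow_add_one hy'.ne']; ring
  · exact ((integrableOn_rpow_mul_exp_neg_mul_sq (b := 1 / 4) (by norm_num)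
      (by linarith : -1 < s + 1)).const_mul _).add
      ((integrableOn_rpow_mul_exp_neg_mul_sq (b := 1 / 4) (by norm_num) hs).const_mul _)
  · refine Filter.Eventually.of_forall fun y z _ => ?_
    refine HasDerivAt.const_mul _ (HasDerivAt.exp ?_)
    have h := ((((hasDerivAt_id z).const_sub y).pow 2).neg).div_const 2
    refine h.congr_deriv ?_
    norm_num

/-- Integration by parts. -/
lemma moment_add_two {s : ℝ} (hs : -1 < s) (x : ℝ) :
    moment (s + 2) x = x * moment (s + 1) x + (s + 1) * moment s x := by
  have hi := integrableOn_rpow_mul_exp hs x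
  have hi1 := integrableOn_rpow_mul_exp (s := s + 1) (by linarith) x
  have hi2 := integrableOn_rpow_mul_exp (s := s + 2) (by linarith) x
  have hint := ((hi.const_mul (s + 1)).sub hi2).add (hi1.const_mul x)
  have hd : ∀ y ∈ Set.Ioi (0 : ℝ), HasDerivAt
      (fun y : ℝ => y ^ (s + 1) * Real.exp (-(y - x) ^ 2 / 2))
      ((s + 1) * (y ^ s * Real.exp (-(y - x) ^ 2 / 2)) -
        y ^ (s + 2) * Real.exp (-(y - x) ^ 2 / 2) +
        x * (y ^ (s + 1) * Real.exp (-(y - x) ^ 2 / 2))) y := by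
    intro y hy
    have hy' : 0 < y := hy
    have h1 := Real.hasDerivAt_rpow_const (x := y) (p := s + 1) (Or.inl hy'.ne')
    have h2 := ((((((hasDerivAt_id y).sub_const x).pow 2).neg).div_const 2).exp)
    refine (h1.mul h2).congr_deriv ?_
    have e2 : y ^ (s + 2) = y ^ s * y * y := by
      rw [show s + 2 = s + 1 + 1 by ring, Real.rpow_add_one hy'.ne', Real.rpow_add_one hy'.ne']
    simp only [add_sub_cancel_right, e2, Real.rpow_add_one hy'.ne', id]
    simp
    ring
  have h := integral_Ioi_of_hasDerivAt_of_tendsto (f := fun y : ℝ =>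
    y ^ (s + 1) * Real.exp (-(y - x) ^ 2 / 2)) (a := 0) (m := 0) ?_ hd hint
    (tendsto_zero_of_hasDerivAt_of_integrableOn_Ioi hd hint hi1)
  · have hadd := integral_add ((hi.const_mul (s + 1)).sub hi2) (hi1.const_mul x)
    simp only [Pi.sub_apply] at hadd
    rw [hadd, integral_sub (hi.const_mul (s + 1)) hi2, integral_const_mul, integral_const_mul,
      Real.zero_rpow (by linarith)] at h
    simp only [moment]
    linarith
  · have h1 : ContinuousAt (fun y : ℝ => y ^ (s + 1)) 0 :=
      Real.continuousAt_rpow_const 0 (s + 1) (Or.inr (by linarith))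
    exact (h1.mul (by fun_prop)).continuousWithinAt

lemma continuousAt_moment {s : ℝ} (hs : -1 < s) (x : ℝ) :
    ContinuousAt (fun r => moment r x) s := by
  obtain ⟨d, hd, hsd⟩ : ∃ d : ℝ, 0 < d ∧ -1 < s - d := ⟨(s + 1) / 2, by linarith, by linarith⟩
  refine continuousAt_of_dominated (bound := fun y : ℝ =>
    y ^ (s - d) * Real.exp (-(y - x) ^ 2 / 2) + y ^ (s + d) * Real.exp (-(y - x) ^ 2 / 2))
    (Filter.Eventually.of_forall fun r => aestronglyMeasurable_rpow_mul_exp r x) ?_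
    ((integrableOn_rpow_mul_exp hsd x).add (integrableOn_rpow_mul_exp (by linarith) x)) ?_
  · filter_upwards [Ioo_mem_nhds (show s - d < s by linarith) (show s < s + d by linarith)]
      with r hr
    refine (ae_restrict_mem measurableSet_Ioi).mono fun y hy => ?_
    have hy' : 0 < y := hy
    have h0 : ∀ r : ℝ, 0 < y ^ r := fun r => Real.rpow_pos_of_pos hy' r
    rw [Real.norm_of_nonneg (mul_nonneg (h0 r).le (Real.exp_pos _).le), ← add_mul]
    refine mul_le_mul_of_nonneg_right ?_ (Real.exp_pos _).le
    rcases le_total y 1 with h1 | h1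
    · linarith [Real.rpow_le_rpow_of_exponent_ge hy' h1 hr.1.le, h0 (s + d)]
    · linarith [Real.rpow_le_rpow_of_exponent_le h1 hr.2.le, h0 (s - d)]
  · refine (ae_restrict_mem measurableSet_Ioi).mono fun y hy => ?_
    exact (Real.continuousAt_const_rpow (ne_of_gt hy)).mul continuousAt_const

/-- The mean `moment (s + 1) x / moment s x` of the weight `y^s exp(-(y-x)²/2)` is nondecreasing
in `s`. -/
lemma moment_mul_moment_le {r s : ℝ} (hr : -1 < r) (hrs : r ≤ s) (x : ℝ) :
    moment (r + 1) x * moment s x ≤ moment (s + 1) x * moment r x := by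
  have hs : -1 < s := by linarith
  have hMs := moment_pos hs x
  set c := moment (s + 1) x / moment s x with hc
  have hcpos : 0 < c := div_pos (moment_pos (by linarith) x) hMs
  have hI : ∀ p : ℝ, -1 < p → IntegrableOn (fun y : ℝ =>
      y ^ (p + 1) * Real.exp (-(y - x) ^ 2 / 2) - c * (y ^ p * Real.exp (-(y - x) ^ 2 / 2)))
      (Set.Ioi 0) := fun p hp =>
    (integrableOn_rpow_mul_exp (s := p + 1) (by linarith) x).sub
      ((integrableOn_rpow_mul_exp hp x).const_mul c)
  have hV : ∀ p : ℝ, -1 < p → ∫ y in Set.Ioi (0 : ℝ),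
      (y ^ (p + 1) * Real.exp (-(y - x) ^ 2 / 2) - c * (y ^ p * Real.exp (-(y - x) ^ 2 / 2))) =
      moment (p + 1) x - c * moment p x := by
    intro p hp
    rw [integral_sub (integrableOn_rpow_mul_exp (s := p + 1) (by linarith) x)
      ((integrableOn_rpow_mul_exp hp x).const_mul c), integral_const_mul]
    rfl
  have hmono := setIntegral_mono_on (hI r hr) ((hI s hs).const_mul (c ^ (r - s)))
    measurableSet_Ioi ?_
  · rw [integral_const_mul, hV r hr, hV s hs, hc, div_mul_cancel₀ _ hMs.ne', sub_self, mul_zero,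
      sub_nonpos, div_mul_eq_mul_div, le_div_iff₀ hMs] at hmono
    exact hmono
  · intro y hy
    have hy' : 0 < y := hy
    have e : y ^ r = y ^ (r - s) * y ^ s := by rw [← Real.rpow_add hy']; ring_nf
    have h0 : 0 < y ^ s * Real.exp (-(y - x) ^ 2 / 2) :=
      mul_pos (Real.rpow_pos_of_pos hy' s) (Real.exp_pos _)
    -- `y - c` and `y^(r-s) - c^(r-s)` have opposite signs
    have hsign : (y - c) * (y ^ (r - s) - c ^ (r - s)) ≤ 0 := by
      rcases le_total y c with h | h
      · exact mul_nonpos_of_nonpos_of_nonneg (by linarith)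
          (sub_nonneg.2 (Real.rpow_le_rpow_of_nonpos hy' h (by linarith)))
      · exact mul_nonpos_of_nonneg_of_nonpos (by linarith)
          (sub_nonpos.2 (Real.rpow_le_rpow_of_nonpos hcpos h (by linarith)))
    rw [Real.rpow_add_one hy'.ne', Real.rpow_add_one hy'.ne', e]
    nlinarith [mul_nonpos_of_nonpos_of_nonneg hsign h0.le]

/-! ### The linear equation `y'' + x y' + a y = 0` -/

/-- `y` solves `y'' + x y' + a y = 0` on `ℝ` and has derivative `y'`. -/
def IsSol (a : ℝ) (y y' : ℝ → ℝ) : Prop :=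
  ∀ x, HasDerivAt y (y' x) x ∧ HasDerivAt y' (-(x * y' x) - a * y x) x

/-- The second derivative `-x y' - a y` of a solution `y` of `y'' + x y' + a y = 0`. -/
def curv (a : ℝ) (y y' : ℝ → ℝ) (x : ℝ) : ℝ :=
  -(x * y' x) - a * y x

namespace IsSol

variable {a b : ℝ} {y y' u u' v v' : ℝ → ℝ}

lemma comb_reflect (h : IsSol a y y') (c d : ℝ) :
    IsSol a (fun x => c * y x + d * y (-x)) (fun x => c * y' x - d * y' (-x)) := by
  intro x
  have h1 := (h x).1
  have h2 := (h x).2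
  have h3 := HasDerivAt.comp x (h (-x)).1 (hasDerivAt_neg x)
  have h4 := HasDerivAt.comp x (h (-x)).2 (hasDerivAt_neg x)
  constructor
  · refine ((h1.const_mul c).add (h3.const_mul d)).congr_deriv ?_
    ring
  · refine ((h2.const_mul c).sub (h4.const_mul d)).congr_deriv ?_
    ring

lemma curv_comb_reflect (a : ℝ) (y y' : ℝ → ℝ) (c d x : ℝ) :
    curv a (fun x => c * y x + d * y (-x)) (fun x => c * y' x - d * y' (-x)) x =
      c * curv a y y' x + d * curv a y y' (-x) := by
  simp only [curv]
  ring

lemma hasDerivAt_curv (h : IsSol a y y') (x : ℝ) :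
    HasDerivAt (curv a y y') (-(x * curv a y y' x) - (1 + a) * y' x) x := by
  refine (((hasDerivAt_id x).mul (h x).2).neg.sub ((h x).1.const_mul a)).congr_deriv ?_
  simp only [curv, id]
  ring

lemma continuous_curv (h : IsSol a y y') : Continuous (curv a y y') :=
  continuous_iff_continuousAt.2 fun x => (h.hasDerivAt_curv x).continuousAt

/-- The curvature of a positive solution, multiplied by a suitable positive weight, increases:
the derivative of `t^{-(1+a)} exp(t²/2) y''` is `a (1 + a) t^{-(2+a)} exp(t²/2) y`. So `y''` has
at most one zero on the positive half-line, where it passes from negative to positive. -/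
lemma strictMonoOn_curv_mul (h : IsSol a y y') (ha : 0 < a) (hy : ∀ t, 0 < t → 0 < y t) :
    StrictMonoOn (fun t => curv a y y' t * (Real.exp (t ^ 2 / 2) * t ^ (-(1 + a))))
      (Set.Ioi 0) := by
  have hd : ∀ t : ℝ, 0 < t → HasDerivAt
      (fun t => curv a y y' t * (Real.exp (t ^ 2 / 2) * t ^ (-(1 + a))))
      ((1 + a) * a * y t * (Real.exp (t ^ 2 / 2) * t ^ (-(1 + a) - 1))) t := by
    intro t ht
    have h1 : HasDerivAt (fun t : ℝ => Real.exp (t ^ 2 / 2)) (Real.exp (t ^ 2 / 2) * t) t := by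
      refine (((hasDerivAt_id t).pow 2).div_const 2).exp.congr_deriv ?_
      simp
    have h2 := Real.hasDerivAt_rpow_const (x := t) (p := -(1 + a)) (Or.inl ht.ne')
    refine ((h.hasDerivAt_curv t).mul (h1.mul h2)).congr_deriv ?_
    have e : t ^ (-(1 + a)) = t ^ (-(1 + a) - 1) * t := by
      rw [← Real.rpow_add_one ht.ne']; ring_nf
    simp only [curv, Pi.mul_apply]
    rw [e]
    ring
  refine strictMonoOn_of_deriv_pos (convex_Ioi 0)
    (fun t ht => (hd t ht).continuousAt.continuousWithinAt) fun t ht => ?_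
  rw [interior_Ioi] at ht
  have ht' : 0 < t := ht
  rw [(hd t ht').deriv]
  have := hy t ht'
  have := Real.rpow_pos_of_pos ht' (-(1 + a) - 1)
  positivity

lemma curv_neg_of_lt (h : IsSol a y y') (ha : 0 < a) (hy : ∀ t, 0 < t → 0 < y t) {s t : ℝ}
    (hs : 0 < s) (hst : s < t) (ht : curv a y y' t ≤ 0) : curv a y y' s < 0 := by
  have hm := h.strictMonoOn_curv_mul ha hy (Set.mem_Ioi.2 hs) (Set.mem_Ioi.2 (hs.trans hst)) hst
  have hws : 0 < Real.exp (s ^ 2 / 2) * s ^ (-(1 + a)) :=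
    mul_pos (Real.exp_pos _) (Real.rpow_pos_of_pos hs _)
  have hwt : 0 < Real.exp (t ^ 2 / 2) * t ^ (-(1 + a)) :=
    mul_pos (Real.exp_pos _) (Real.rpow_pos_of_pos (hs.trans hst) _)
  simp only at hm
  by_contra hc
  linarith [mul_nonneg (not_lt.1 hc) hws.le, mul_nonpos_of_nonpos_of_nonneg ht hwt.le]

lemma curv_pos_of_lt (h : IsSol a y y') (ha : 0 < a) (hy : ∀ t, 0 < t → 0 < y t) {s t : ℝ}
    (hs : 0 < s) (hst : s < t) (hc : 0 ≤ curv a y y' s) : 0 < curv a y y' t := by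
  by_contra ht
  exact absurd (h.curv_neg_of_lt ha hy hs hst (not_lt.1 ht)) (not_lt.2 hc)

lemma curv_neg_iff (h : IsSol a y y') (ha : 0 < a) (hy : ∀ t, 0 < t → 0 < y t) {r t : ℝ}
    (hr : 0 < r) (hr0 : curv a y y' r = 0) (ht : 0 < t) : curv a y y' t < 0 ↔ t < r := by
  refine ⟨fun hc => ?_, fun htr => h.curv_neg_of_lt ha hy ht htr hr0.le⟩
  by_contra htr
  rcases (not_lt.1 htr).eq_or_lt with rfl | hlt
  · exact absurd hr0 hc.ne
  · exact absurd (h.curv_pos_of_lt ha hy hr hlt hr0.ge) (not_lt.2 hc.le)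

lemma curv_pos_iff (h : IsSol a y y') (ha : 0 < a) (hy : ∀ t, 0 < t → 0 < y t) {r t : ℝ}
    (hr : 0 < r) (hr0 : curv a y y' r = 0) (ht : 0 < t) : 0 < curv a y y' t ↔ r < t := by
  refine ⟨fun hc => ?_, fun hrt => h.curv_pos_of_lt ha hy hr hrt hr0.ge⟩
  by_contra htr
  rcases (not_lt.1 htr).eq_or_lt with rfl | hlt
  · exact absurd hr0 hc.ne'
  · exact absurd (h.curv_neg_of_lt ha hy ht hlt hr0.le) (not_lt.2 hc.le)

lemma deriv_neg (h : IsSol a u u') (ha : 0 < a) (hu : ∀ t, 0 < u t) (h0 : u' 0 = 0) {t : ℝ}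
    (ht : 0 < t) : u' t < 0 := by
  have hd : ∀ t : ℝ, HasDerivAt (fun t => u' t * Real.exp (t ^ 2 / 2))
      (-(a * u t * Real.exp (t ^ 2 / 2))) t := by
    intro t
    have h1 : HasDerivAt (fun t : ℝ => Real.exp (t ^ 2 / 2)) (Real.exp (t ^ 2 / 2) * t) t := by
      refine (((hasDerivAt_id t).pow 2).div_const 2).exp.congr_deriv ?_
      simp
    refine ((h t).2.mul h1).congr_deriv ?_
    ring
  have hanti : StrictAnti fun t => u' t * Real.exp (t ^ 2 / 2) := by
    refine strictAnti_of_deriv_neg fun t => ?_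
    rw [(hd t).deriv]
    have := hu t
    have := Real.exp_pos (t ^ 2 / 2)
    nlinarith [mul_pos (mul_pos ha (hu t)) this]
  have hlt := hanti ht
  simp only [h0, zero_mul] at hlt
  by_contra hc
  exact absurd hlt (not_lt.2 (mul_nonneg (not_lt.1 hc) (Real.exp_pos _).le))

/-- A positive solution cannot stay concave on the whole half-line. -/
lemma exists_curv_eq_zero (h : IsSol a u u') (ha : 0 < a) (hu : ∀ t, 0 < u t) (h0 : u' 0 = 0) :
    ∃ z, 0 < z ∧ curv a u u' z = 0 := by
  have hneg0 : curv a u u' 0 < 0 := by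
    simp only [curv]
    nlinarith [mul_pos ha (hu 0)]
  by_cases hex : ∃ t, 0 < t ∧ 0 ≤ curv a u u' t
  · obtain ⟨t, ht, hct⟩ := hex
    obtain ⟨z, hz, hz0⟩ := intermediate_value_Icc ht.le h.continuous_curv.continuousOn
      (show (0 : ℝ) ∈ Set.Icc _ _ from ⟨hneg0.le, hct⟩)
    refine ⟨z, lt_of_le_of_ne hz.1 ?_, hz0⟩
    rintro rfl
    exact absurd hz0 hneg0.ne
  · push Not at hex
    exfalso
    have hanti : AntitoneOn u' (Set.Ici 0) := by
      refine antitoneOn_of_deriv_nonpos (convex_Ici 0)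
        (fun t _ => (h t).2.continuousAt.continuousWithinAt)
        (fun t _ => (h t).2.differentiableAt.differentiableWithinAt) fun t ht => ?_
      rw [interior_Ici] at ht
      rw [(h t).2.deriv]
      exact (hex t ht).le
    have h1 := h.deriv_neg ha hu h0 one_pos
    -- the tangent at `1` lies above the graph and becomes negative
    set T : ℝ := 1 + u 1 / (-u' 1) with hT
    have hT1 : 1 < T := by
      have := div_pos (hu 1) (neg_pos.2 h1)
      linarith
    obtain ⟨c, hc, hcs⟩ := exists_hasDerivAt_eq_slope u u' hT1
      (fun t _ => (h t).1.continuousAt.continuousWithinAt) (fun t _ => (h t).1)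
    have hle : u' c ≤ u' 1 := hanti (Set.mem_Ici.2 zero_le_one)
      (Set.mem_Ici.2 (by linarith [hc.1])) hc.1.le
    rw [hcs, div_le_iff₀ (by linarith)] at hle
    have he : u' 1 * (T - 1) = -u 1 := by
      rw [hT]; field_simp [h1.ne]; ring
    linarith [hu T]

/-- Comparison in the parameter: `Q = -u' / (a u)` satisfies `Q' = 1 - t Q + a Q²`, `Q(0) = 0`, and
so increases with `a`; the curvature is nonnegative exactly where `t Q ≥ 1`. -/
lemma curv_pos_of_param_lt (hu : IsSol a u u') (hv : IsSol b v v') (ha : 0 < a) (hab : a < b)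
    (hu0 : ∀ t, 0 < u t) (hv0 : ∀ t, 0 < v t) (hu' : u' 0 = 0) (hv' : v' 0 = 0) {t : ℝ}
    (ht : 0 < t) (hc : 0 ≤ curv a u u' t) : 0 < curv b v v' t := by
  have hb : 0 < b := ha.trans hab
  -- the exponent is minus a primitive of the coefficient of the difference of the two
  -- functions `Q` in the linear equation which this difference satisfies
  set E : ℝ → ℝ := fun t =>
    Real.exp (t ^ 2 / 2 + Real.log (v t) + b / a * Real.log (u t)) with hE
  have hd : ∀ t, HasDerivAt (fun t => (-v' t / (b * v t) - -u' t / (a * u t)) * E t)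
      ((b - a) * (u' t / (a * u t)) ^ 2 * E t) t := by
    intro t
    have hut := (hu0 t).ne'
    have hvt := (hv0 t).ne'
    have hEd : HasDerivAt E (E t * (t + v' t / v t + b / a * (u' t / u t))) t := by
      refine ((((hasDerivAt_id t).pow 2).div_const 2).add ((hv t).1.log hvt) |>.add
        (((hu t).1.log hut).const_mul (b / a))).exp.congr_deriv ?_
      simp [hE]
    have hq1 := (hv t).2.neg.div ((hv t).1.const_mul b) (mul_ne_zero hb.ne' hvt)
    have hq2 := (hu t).2.neg.div ((hu t).1.const_mul a) (mul_ne_zero ha.ne' hut)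
    refine ((hq1.sub hq2).mul hEd).congr_deriv ?_
    simp only [Pi.sub_apply, Pi.div_apply, Pi.neg_apply]
    field_simp
    ring
  have hmono : StrictMonoOn (fun t => (-v' t / (b * v t) - -u' t / (a * u t)) * E t)
      (Set.Ici 0) := by
    refine strictMonoOn_of_deriv_pos (convex_Ici 0)
      (fun t _ => (hd t).continuousAt.continuousWithinAt) fun t ht => ?_
    rw [interior_Ici] at ht
    rw [(hd t).deriv]
    have h1 := hu.deriv_neg ha hu0 hu' ht
    have h2 : u' t / (a * u t) ≠ 0 := div_ne_zero h1.ne (mul_pos ha (hu0 t)).ne'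
    have h3 : 0 < E t := Real.exp_pos _
    have h4 : 0 < b - a := sub_pos.2 hab
    positivity
  have hlt := hmono (Set.mem_Ici.2 le_rfl) (Set.mem_Ici.2 ht.le) ht
  simp only [hu', hv', neg_zero, zero_div, sub_zero, zero_mul] at hlt
  have hQ : -u' t / (a * u t) < -v' t / (b * v t) := by
    by_contra hcon
    exact absurd hlt (not_lt.2 (mul_nonpos_of_nonpos_of_nonneg
      (by linarith [not_lt.1 hcon]) (Real.exp_pos _).le))
  have hau := mul_pos ha (hu0 t)
  have hbv := mul_pos hb (hv0 t)
  simp only [curv] at hc ⊢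
  have h1 : 1 ≤ t * (-u' t / (a * u t)) := by
    rw [mul_div_assoc', le_div_iff₀ hau]; linarith
  have h2 : 1 < t * (-v' t / (b * v t)) := h1.trans_lt (mul_lt_mul_of_pos_left hQ ht)
  rw [mul_div_assoc', lt_div_iff₀ hbv] at h2
  linarith

/-- As `a → 1` the even solution approaches a multiple of `exp(-t²/2)`, whose curvature is positive
beyond `1`: the function `m = t + u' / u` satisfies `m' = (1 - a) + t m - m²` and `m(0) = 0`, so
that `m ≤ (1 - a) t exp(t²/2)`. -/
lemma curv_pos_of_one_sub_lt (h : IsSol a u u') (ha1 : a ≤ 1) (hu : ∀ t, 0 < u t)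
    (h0 : u' 0 = 0) {t : ℝ} (ht : 0 < t)
    (hta : (1 - a) * (t ^ 2 * Real.exp (t ^ 2 / 2)) < t ^ 2 - a) : 0 < curv a u u' t := by
  have hd : ∀ t, HasDerivAt
      (fun t : ℝ => (1 - a) * t - (t + u' t / u t) * Real.exp (-(t ^ 2 / 2)))
      ((1 - a) - ((1 - a) - (t + u' t / u t) ^ 2) * Real.exp (-(t ^ 2 / 2))) t := by
    intro t
    have hut := (hu t).ne'
    have h1 : HasDerivAt (fun t : ℝ => Real.exp (-(t ^ 2 / 2)))
        (Real.exp (-(t ^ 2 / 2)) * (-t)) t := by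
      refine (((hasDerivAt_id t).pow 2).div_const 2).neg.exp.congr_deriv ?_
      simp
    refine (((hasDerivAt_id t).const_mul (1 - a)).sub
      (((hasDerivAt_id t).add ((h t).2.div (h t).1 hut)).mul h1)).congr_deriv ?_
    simp only [Pi.add_apply, Pi.div_apply, id]
    field_simp
    ring
  have hmono : Monotone
      (fun t : ℝ => (1 - a) * t - (t + u' t / u t) * Real.exp (-(t ^ 2 / 2))) := by
    refine monotone_of_deriv_nonneg (fun t => (hd t).differentiableAt) fun t => ?_
    rw [(hd t).deriv]
    have h1 : Real.exp (-(t ^ 2 / 2)) ≤ 1 := Real.exp_le_one_iff.2 (by nlinarith [sq_nonneg t])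
    have h2 := Real.exp_pos (-(t ^ 2 / 2))
    nlinarith [mul_nonneg (sq_nonneg (t + u' t / u t)) h2.le,
      mul_nonneg (sub_nonneg.2 ha1) (sub_nonneg.2 h1)]
  have hle := hmono ht.le
  simp only [h0, zero_div, add_zero, mul_zero, zero_mul, sub_self, sub_nonneg] at hle
  have hm : t + u' t / u t ≤ (1 - a) * t * Real.exp (t ^ 2 / 2) := by
    rw [Real.exp_neg, ← div_eq_mul_inv, div_le_iff₀ (Real.exp_pos _)] at hle
    exact hle
  have hut := hu t
  have e : curv a u u' t = (t ^ 2 - a - t * (t + u' t / u t)) * u t := by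
    simp only [curv]; field_simp; ring
  rw [e]
  refine mul_pos ?_ hut
  nlinarith [mul_le_mul_of_nonneg_left hm ht.le]

end IsSol

/-! ### The function `phi` as a solution -/

/-- The first derivative of `phi l`. -/
noncomputable def dphi (l x : ℝ) : ℝ :=
  moment (-2 * l + 1) x - x * moment (-2 * l) x

variable {l m : ℝ}

lemma isSol_phi (hl : l < 1 / 2) : IsSol (2 * l) (phi l) (dphi l) := by
  intro x
  have h0 := hasDerivAt_moment (s := -2 * l) (by linarith) x
  have h1 := hasDerivAt_moment (s := -2 * l + 1) (by linarith) x
  refine ⟨h0, (h1.sub ((hasDerivAt_id x).mul h0)).congr_deriv ?_⟩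
  rw [show -2 * l + 1 + 1 = -2 * l + 2 by ring, moment_add_two (by linarith) x, phi_eq_moment]
  simp only [dphi, id]
  ring

lemma phi_pos (hl : l < 1 / 2) (x : ℝ) : 0 < phi l x :=
  moment_pos (by linarith) x

lemma phi''_eq_curv (hl : l < 1 / 2) (x : ℝ) :
    phi'' l x = curv (2 * l) (phi l) (dphi l) x := by
  have h := isSol_phi hl
  have h1 : deriv (phi l) = dphi l := funext fun x => (h x).1.deriv
  rw [phi'', h1, (h x).2.deriv]
  rfl

lemma phi''_eq_moment (hl : l < 1 / 2) (x : ℝ) :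
    phi'' l x = (x ^ 2 - 2 * l) * moment (-2 * l) x - x * moment (-2 * l + 1) x := by
  rw [phi''_eq_curv hl, curv, dphi, phi_eq_moment]
  ring

lemma continuous_phi'' (hl : l < 1 / 2) : Continuous (phi'' l) := by
  rw [funext (phi''_eq_curv hl)]
  exact (isSol_phi hl).continuous_curv

lemma continuousOn_phi''_param (x : ℝ) :
    ContinuousOn (fun l => phi'' l x) (Set.Ioo 0 (1 / 2)) := by
  have h : ContinuousOn (fun l : ℝ => (x ^ 2 - 2 * l) * moment (-2 * l) x -
      x * moment (-2 * l + 1) x) (Set.Ioo 0 (1 / 2)) := by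
    intro l hl
    have h0 : ContinuousAt (fun l : ℝ => moment (-2 * l) x) l :=
      ContinuousAt.comp (g := fun r => moment r x) (f := fun l : ℝ => -2 * l)
        (continuousAt_moment (by linarith [hl.2]) x) (by fun_prop)
    have h1 : ContinuousAt (fun l : ℝ => moment (-2 * l + 1) x) l :=
      ContinuousAt.comp (g := fun r => moment r x) (f := fun l : ℝ => -2 * l + 1)
        (continuousAt_moment (by linarith [hl.2]) x) (by fun_prop)
    have h2 : ContinuousAt (fun l : ℝ => x ^ 2 - 2 * l) l := by fun_prop
    exact ((h2.mul h0).sub (continuousAt_const.mul h1)).continuousWithinAt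
  exact h.congr fun l hl => phi''_eq_moment hl.2 x

/-! ### The negative zero of `phi''` -/

lemma isSol_phi_reflect (hl : l < 1 / 2) : IsSol (2 * l)
    (fun x => 0 * phi l x + 1 * phi l (-x)) (fun x => 0 * dphi l x - 1 * dphi l (-x)) :=
  (isSol_phi hl).comb_reflect 0 1

lemma curv_phi_reflect (hl : l < 1 / 2) (x : ℝ) :
    curv (2 * l) (fun x => 0 * phi l x + 1 * phi l (-x))
      (fun x => 0 * dphi l x - 1 * dphi l (-x)) x = phi'' l (-x) := by
  rw [IsSol.curv_comb_reflect, phi''_eq_curv hl]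
  ring

lemma phi_reflect_pos (hl : l < 1 / 2) (x : ℝ) : 0 < 0 * phi l x + 1 * phi l (-x) := by
  have := phi_pos hl (-x)
  linarith

lemma phi''_neg_pos (hl : l < 1 / 2) {t : ℝ} (ht : 0 < t) (htl : 2 * l ≤ t ^ 2) :
    0 < phi'' l (-t) := by
  rw [phi''_eq_moment hl]
  have h0 := moment_pos (s := -2 * l) (by linarith) (-t)
  have h1 := moment_pos (s := -2 * l + 1) (by linarith) (-t)
  nlinarith [mul_pos ht h1, mul_nonneg (sub_nonneg.2 htl) h0.le]

lemma phi''_neg_neg (hl : l < 1 / 2) {t : ℝ} (htl : t ^ 2 + 1 ≤ 4 * l) :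
    phi'' l (-t) < 0 := by
  rw [phi''_eq_moment hl]
  have h0 := moment_pos (s := -2 * l) (by linarith) (-t)
  have h2 := moment_pos (s := -2 * l + 2) (by linarith) (-t)
  rw [moment_add_two (by linarith)] at h2
  nlinarith [mul_nonneg (sub_nonneg.2 htl) h0.le]

lemma phi''_zero_neg (h0 : 0 < l) (hl : l < 1 / 2) : phi'' l 0 < 0 := by
  rw [phi''_eq_moment hl]
  have := moment_pos (s := -2 * l) (by linarith) 0
  nlinarith [mul_pos h0 this]

lemma existsUnique_isX1 (h0 : 0 < l) (hl : l < 1 / 2) : ∃! x, IsX1 l x := by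
  have hc : Continuous fun t => phi'' l (-t) := (continuous_phi'' hl).comp continuous_neg
  obtain ⟨t, ht, ht0⟩ := intermediate_value_Icc (f := fun t => phi'' l (-t)) zero_le_one
    hc.continuousOn (show (0 : ℝ) ∈ Set.Icc _ _ from
      ⟨by simpa using (phi''_zero_neg h0 hl).le,
        (phi''_neg_pos hl one_pos (by linarith)).le⟩)
  have ht0' : phi'' l (-t) = 0 := ht0
  have htpos : 0 < t := by
    refine lt_of_le_of_ne ht.1 ?_
    rintro rfl
    rw [neg_zero] at ht0'
    exact absurd ht0' (phi''_zero_neg h0 hl).ne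
  refine ⟨-t, ⟨by linarith, ht0'⟩, fun x hx => ?_⟩
  have hsol := isSol_phi_reflect hl
  have ha : 0 < 2 * l := by linarith
  have hx0 : 0 < -x := neg_pos.2 hx.1
  have hcx : phi'' l (- -x) = 0 := by rw [neg_neg]; exact hx.2
  have hr0 := (curv_phi_reflect hl t).trans ht0'
  have hx1 := (curv_phi_reflect hl (-x)).trans hcx
  have hy := fun t (_ : 0 < t) => phi_reflect_pos hl t
  have h1 := (hsol.curv_neg_iff ha hy htpos hr0 hx0).not.1 hx1.not_lt
  have h2 := (hsol.curv_pos_iff ha hy htpos hr0 hx0).not.1 hx1.not_gt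
  linarith

lemma isX1_x1 (h0 : 0 < l) (hl : l < 1 / 2) : IsX1 l (x1 l) :=
  Classical.epsilon_spec (existsUnique_isX1 h0 hl).exists

lemma neg_x1_pos (h0 : 0 < l) (hl : l < 1 / 2) : 0 < -x1 l :=
  neg_pos.2 (isX1_x1 h0 hl).1

lemma phi''_neg_neg_iff (h0 : 0 < l) (hl : l < 1 / 2) {t : ℝ} (ht : 0 < t) :
    phi'' l (-t) < 0 ↔ t < -x1 l := by
  rw [← curv_phi_reflect hl]
  refine (isSol_phi_reflect hl).curv_neg_iff (by linarith) (fun t _ => phi_reflect_pos hl t)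
    (neg_x1_pos h0 hl) ?_ ht
  rw [curv_phi_reflect hl, neg_neg]
  exact (isX1_x1 h0 hl).2

lemma phi''_neg_pos_iff (h0 : 0 < l) (hl : l < 1 / 2) {t : ℝ} (ht : 0 < t) :
    0 < phi'' l (-t) ↔ -x1 l < t := by
  rw [← curv_phi_reflect hl]
  refine (isSol_phi_reflect hl).curv_pos_iff (by linarith) (fun t _ => phi_reflect_pos hl t)
    (neg_x1_pos h0 hl) ?_ ht
  rw [curv_phi_reflect hl, neg_neg]
  exact (isX1_x1 h0 hl).2

lemma neg_x1_lt_neg_x1 (h0 : 0 < l) (hlm : l < m) (hm : m < 1 / 2) : -x1 l < -x1 m := by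
  have hm0 : 0 < m := h0.trans hlm
  have hl : l < 1 / 2 := hlm.trans hm
  have ht := neg_x1_pos hm0 hm
  rw [← phi''_neg_pos_iff h0 hl ht]
  have hz : phi'' m (- -x1 m) = 0 := by rw [neg_neg]; exact (isX1_x1 hm0 hm).2
  set t := -x1 m
  rw [phi''_eq_moment hm] at hz
  rw [phi''_eq_moment hl]
  have hcmp := moment_mul_moment_le (r := -2 * m) (s := -2 * l) (by linarith) (by linarith) (-t)
  have hl0 := moment_pos (s := -2 * l) (by linarith) (-t)
  have hm0 := moment_pos (s := -2 * m) (by linarith) (-t)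
  refine pos_of_mul_pos_left (b := moment (-2 * m) (-t)) ?_ hm0.le
  have h1 : (t ^ 2 - 2 * m) * moment (-2 * m) (-t) = -(t * moment (-2 * m + 1) (-t)) := by
    linarith
  have h2 : 0 < (2 * m - 2 * l) * (moment (-2 * m) (-t) * moment (-2 * l) (-t)) :=
    mul_pos (by linarith) (mul_pos hm0 hl0)
  have h3 := mul_le_mul_of_nonneg_left hcmp ht.le
  linear_combination (exp := 1) h2 + h3 - moment (-2 * l) (-t) * h1

/-! ### The positive zero of the even part of `phi''` -/

lemma isSol_phi_even (hl : l < 1 / 2) : IsSol (2 * l)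
    (fun x => 1 * phi l x + 1 * phi l (-x)) (fun x => 1 * dphi l x - 1 * dphi l (-x)) :=
  (isSol_phi hl).comb_reflect 1 1

lemma curv_phi_even (hl : l < 1 / 2) (x : ℝ) :
    curv (2 * l) (fun x => 1 * phi l x + 1 * phi l (-x))
      (fun x => 1 * dphi l x - 1 * dphi l (-x)) x = phi'' l x + phi'' l (-x) := by
  rw [IsSol.curv_comb_reflect, phi''_eq_curv hl, phi''_eq_curv hl]
  ring

lemma phi_even_pos (hl : l < 1 / 2) (x : ℝ) : 0 < 1 * phi l x + 1 * phi l (-x) := by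
  linarith [phi_pos hl x, phi_pos hl (-x)]

lemma dphi_even_zero (l : ℝ) : 1 * dphi l 0 - 1 * dphi l (-0) = 0 := by
  simp

lemma existsUnique_isZ (h0 : 0 < l) (hl : l < 1 / 2) : ∃! z, IsZ l z := by
  have hsol := isSol_phi_even hl
  have ha : 0 < 2 * l := by linarith
  obtain ⟨z, hz, hz0⟩ := hsol.exists_curv_eq_zero ha (phi_even_pos hl) (dphi_even_zero l)
  refine ⟨z, ⟨hz, (curv_phi_even hl z).symm.trans hz0⟩, fun x hx => ?_⟩
  have hx0 := (curv_phi_even hl x).trans hx.2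
  have hy := fun t (_ : 0 < t) => phi_even_pos hl t
  have h1 := (hsol.curv_neg_iff ha hy hz hz0 hx.1).not.1 hx0.not_lt
  have h2 := (hsol.curv_pos_iff ha hy hz hz0 hx.1).not.1 hx0.not_gt
  linarith

lemma isZ_zeta (h0 : 0 < l) (hl : l < 1 / 2) : IsZ l (zeta l) :=
  Classical.epsilon_spec (existsUnique_isZ h0 hl).exists

lemma zeta_pos (h0 : 0 < l) (hl : l < 1 / 2) : 0 < zeta l :=
  (isZ_zeta h0 hl).1

lemma phi''_even_neg_iff (h0 : 0 < l) (hl : l < 1 / 2) {t : ℝ} (ht : 0 < t) :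
    phi'' l t + phi'' l (-t) < 0 ↔ t < zeta l := by
  rw [← curv_phi_even hl]
  refine (isSol_phi_even hl).curv_neg_iff (by linarith) (fun t _ => phi_even_pos hl t)
    (zeta_pos h0 hl) ?_ ht
  rw [curv_phi_even hl]
  exact (isZ_zeta h0 hl).2

lemma phi''_even_pos_iff (h0 : 0 < l) (hl : l < 1 / 2) {t : ℝ} (ht : 0 < t) :
    0 < phi'' l t + phi'' l (-t) ↔ zeta l < t := by
  rw [← curv_phi_even hl]
  refine (isSol_phi_even hl).curv_pos_iff (by linarith) (fun t _ => phi_even_pos hl t)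
    (zeta_pos h0 hl) ?_ ht
  rw [curv_phi_even hl]
  exact (isZ_zeta h0 hl).2

lemma zeta_lt_zeta (h0 : 0 < l) (hlm : l < m) (hm : m < 1 / 2) : zeta m < zeta l := by
  have hl : l < 1 / 2 := hlm.trans hm
  have hz := isZ_zeta h0 hl
  rw [← phi''_even_pos_iff (h0.trans hlm) hm hz.1, ← curv_phi_even hm]
  refine (isSol_phi_even hl).curv_pos_of_param_lt (isSol_phi_even hm) (by linarith) (by linarith)
    (phi_even_pos hl) (phi_even_pos hm) (dphi_even_zero l) (dphi_even_zero m) hz.1 ?_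
  rw [curv_phi_even hl, hz.2]

/-! ### The bijection `l ↦ sigmaOf l` -/

/-- A positive zero at which the sign changes depends continuously on the parameter. -/
lemma continuousOn_of_sign_iff {S : ℝ → ℝ → ℝ} {r : ℝ → ℝ} {I : Set ℝ}
    (hS : ∀ t, ContinuousOn (fun l => S l t) I) (hr : ∀ l ∈ I, 0 < r l)
    (hneg : ∀ l ∈ I, ∀ t, 0 < t → (S l t < 0 ↔ t < r l))
    (hpos : ∀ l ∈ I, ∀ t, 0 < t → (0 < S l t ↔ r l < t)) : ContinuousOn r I := by
  intro l hl
  refine tendsto_order.2 ⟨fun p hp => ?_, fun p hp => ?_⟩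
  · rcases le_or_gt p 0 with hp0 | hp0
    · filter_upwards [self_mem_nhdsWithin] with k hk
      exact hp0.trans_lt (hr k hk)
    · filter_upwards [self_mem_nhdsWithin,
        (hS p l hl).eventually_lt_const ((hneg l hl p hp0).2 hp)] with k hk hkp
      exact (hneg k hk p hp0).1 hkp
  · have hp0 : 0 < p := (hr l hl).trans hp
    filter_upwards [self_mem_nhdsWithin,
      (hS p l hl).eventually_const_lt ((hpos l hl p hp0).2 hp)] with k hk hkp
    exact (hpos k hk p hp0).1 hkp

lemma continuousOn_sigmaOf : ContinuousOn sigmaOf (Set.Ioo 0 (1 / 2)) := by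
  have hx : ContinuousOn (fun l => -x1 l) (Set.Ioo 0 (1 / 2)) :=
    continuousOn_of_sign_iff (S := fun l t => phi'' l (-t))
      (fun t => continuousOn_phi''_param (-t)) (fun l hl => neg_x1_pos hl.1 hl.2)
      (fun l hl t ht => phi''_neg_neg_iff hl.1 hl.2 ht)
      (fun l hl t ht => phi''_neg_pos_iff hl.1 hl.2 ht)
  have hz : ContinuousOn zeta (Set.Ioo 0 (1 / 2)) :=
    continuousOn_of_sign_iff (S := fun l t => phi'' l t + phi'' l (-t))
      (fun t => (continuousOn_phi''_param t).add (continuousOn_phi''_param (-t)))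
      (fun l hl => zeta_pos hl.1 hl.2)
      (fun l hl t ht => phi''_even_neg_iff hl.1 hl.2 ht)
      (fun l hl t ht => phi''_even_pos_iff hl.1 hl.2 ht)
  exact hx.div hz fun l hl => (zeta_pos hl.1 hl.2).ne'

lemma strictMonoOn_sigmaOf : StrictMonoOn sigmaOf (Set.Ioo 0 (1 / 2)) := by
  intro l hl m hm hlm
  exact div_lt_div₀ (neg_x1_lt_neg_x1 hl.1 hlm hm.2) (zeta_lt_zeta hl.1 hlm hm.2).le
    (neg_x1_pos hm.1 hm.2).le (zeta_pos hm.1 hm.2)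

lemma exists_sigmaOf_lt {σ : ℝ} (hσ : 0 < σ) : ∃ l ∈ Set.Ioo (0 : ℝ) (1 / 2), sigmaOf l < σ := by
  have hZ : 0 < zeta (1 / 4) := zeta_pos (by norm_num) (by norm_num)
  have ht : 0 < σ * zeta (1 / 4) := mul_pos hσ hZ
  set l : ℝ := min (1 / 8) ((σ * zeta (1 / 4)) ^ 2 / 2) with hl
  have h0 : 0 < l := lt_min (by norm_num) (by positivity)
  have h1 : l ≤ 1 / 8 := min_le_left _ _
  have h2 : l ≤ (σ * zeta (1 / 4)) ^ 2 / 2 := min_le_right _ _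
  have hl2 : l < 1 / 2 := by linarith
  refine ⟨l, ⟨h0, hl2⟩, ?_⟩
  have hx := (phi''_neg_pos_iff h0 hl2 ht).1 (phi''_neg_pos hl2 ht (by linarith))
  have hz := zeta_lt_zeta h0 (show l < 1 / 4 by linarith) (by norm_num)
  rw [sigmaOf, div_lt_iff₀ (zeta_pos h0 hl2)]
  exact hx.trans (mul_lt_mul_of_pos_left hz hσ)

lemma exists_lt_sigmaOf {σ : ℝ} (hσ : 0 < σ) (hσ1 : σ < 1) :
    ∃ l ∈ Set.Ioo (0 : ℝ) (1 / 2), σ < sigmaOf l := by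
  -- as `l → 1/2` both zeros tend to `1`; it suffices that `-x1 l > s` and `zeta l < r`
  obtain ⟨s, hσs, hs1⟩ := exists_between hσ1
  have hs0 : 0 < s := hσ.trans hσs
  set r : ℝ := s / σ with hr
  have hr1 : 1 < r := (one_lt_div hσ).2 hσs
  have hr0 : 0 < r := by linarith
  set K : ℝ := r ^ 2 * Real.exp (r ^ 2 / 2) with hK
  have hK0 : 0 < K := mul_pos (by positivity) (Real.exp_pos _)
  have hr2 : 0 < r ^ 2 - 1 := by nlinarith
  have hs2 : 0 < 1 - s ^ 2 := by nlinarith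
  obtain ⟨d, hd0, hd⟩ : ∃ d, 0 < d ∧ d < min (min (1 / 2) ((1 - s ^ 2) / 2)) ((r ^ 2 - 1) / K) :=
    exists_between (lt_min (lt_min (by norm_num) (by linarith)) (div_pos hr2 hK0))
  obtain ⟨⟨hd1, hd2⟩, hd3⟩ : (d < 1 / 2 ∧ d < (1 - s ^ 2) / 2) ∧ d < (r ^ 2 - 1) / K := by
    simpa only [lt_min_iff] using hd
  rw [lt_div_iff₀ hK0] at hd3
  have h0 : 0 < (1 - d) / 2 := by linarith
  have hl : (1 - d) / 2 < 1 / 2 := by linarith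
  refine ⟨(1 - d) / 2, ⟨h0, hl⟩, ?_⟩
  have hx : s < -x1 ((1 - d) / 2) :=
    (phi''_neg_neg_iff h0 hl hs0).1 (phi''_neg_neg hl (by linarith))
  have hz : zeta ((1 - d) / 2) < r := by
    rw [← phi''_even_pos_iff h0 hl hr0, ← curv_phi_even hl]
    refine (isSol_phi_even hl).curv_pos_of_one_sub_lt (by linarith) (phi_even_pos hl)
      (dphi_even_zero _) hr0 ?_
    rw [show 2 * ((1 - d) / 2) = 1 - d by ring, ← hK, sub_sub_cancel]
    linarith
  rw [sigmaOf, lt_div_iff₀ (zeta_pos h0 hl)]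
  calc σ * zeta ((1 - d) / 2) < σ * r := mul_lt_mul_of_pos_left hz hσ
    _ = s := by rw [hr]; field_simp
    _ < _ := hx

lemma existsUnique_isLambda {σ : ℝ} (hσ : 0 < σ) (hσ1 : σ < 1) : ∃! l, IsLambda σ l := by
  obtain ⟨p, hp, hpσ⟩ := exists_sigmaOf_lt hσ
  obtain ⟨q, hq, hqσ⟩ := exists_lt_sigmaOf hσ hσ1
  obtain ⟨l, hl, hlσ⟩ := isPreconnected_Ioo.intermediate_value hp hq continuousOn_sigmaOf
    ⟨hpσ.le, hqσ.le⟩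
  exact ⟨l, ⟨hl, hlσ⟩, fun k hk => strictMonoOn_sigmaOf.injOn hk.1 hl (hk.2.trans hlσ.symm)⟩

lemma isLambda_lambdaOf {σ : ℝ} (hσ : 0 < σ) (hσ1 : σ < 1) : IsLambda σ (lambdaOf σ) :=
  Classical.epsilon_spec (existsUnique_isLambda hσ hσ1).exists

/-! ### Gluing twice differentiable functions -/

/-- `f` is twice continuously differentiable with derivatives `f'` and `f''`. -/
structure HasC2Derivs (f f' f'' : ℝ → ℝ) : Prop where
  fst : ∀ x, HasDerivAt f (f' x) x
  snd : ∀ x, HasDerivAt f' (f'' x) x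
  cont : Continuous f''

lemma hasDerivAt_glue {f f' g g' : ℝ → ℝ} (hf : ∀ x, HasDerivAt f (f' x) x)
    (hg : ∀ x, HasDerivAt g (g' x) x) {c : ℝ} (h0 : f c = g c) (h1 : f' c = g' c) (x : ℝ) :
    HasDerivAt (fun x => if x ≤ c then f x else g x) (if x ≤ c then f' x else g' x) x := by
  rcases lt_trichotomy x c with h | rfl | h
  · rw [if_pos h.le]
    refine (hf x).congr_of_eventuallyEq ?_
    filter_upwards [Iio_mem_nhds h] with y hy
    exact if_pos (le_of_lt hy)
  · rw [if_pos le_rfl, ← hasDerivWithinAt_univ, ← Set.Iic_union_Ici (a := x)]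
    refine HasDerivWithinAt.union ?_ ?_
    · exact (hf x).hasDerivWithinAt.congr (fun y hy => if_pos hy) (if_pos le_rfl)
    · rw [h1]
      refine (hg x).hasDerivWithinAt.congr (fun y hy => ?_) (by rw [if_pos le_rfl, h0])
      rcases (show x ≤ y from hy).eq_or_lt with rfl | hlt
      · rw [if_pos le_rfl, h0]
      · exact if_neg (not_le.2 hlt)
  · rw [if_neg (not_le.2 h)]
    refine (hg x).congr_of_eventuallyEq ?_
    filter_upwards [Ioi_mem_nhds h] with y hy
    exact if_neg (not_le.2 hy)

namespace HasC2Derivs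

variable {f f' f'' g g' g'' : ℝ → ℝ}

lemma glue (hf : HasC2Derivs f f' f'') (hg : HasC2Derivs g g' g'') {c : ℝ} (h0 : f c = g c)
    (h1 : f' c = g' c) (h2 : f'' c = g'' c) :
    HasC2Derivs (fun x => if x ≤ c then f x else g x) (fun x => if x ≤ c then f' x else g' x)
      (fun x => if x ≤ c then f'' x else g'' x) :=
  ⟨hasDerivAt_glue hf.fst hg.fst h0 h1, hasDerivAt_glue hf.snd hg.snd h1 h2,
    Continuous.if_le hf.cont hg.cont continuous_id continuous_const
      fun x hx => by rw [show x = c from hx, h2]⟩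

lemma deriv_eq (hf : HasC2Derivs f f' f'') : deriv f = f' :=
  funext fun x => (hf.fst x).deriv

lemma deriv_deriv_eq (hf : HasC2Derivs f f' f'') : deriv (deriv f) = f'' := by
  rw [hf.deriv_eq]
  exact funext fun x => (hf.snd x).deriv

lemma contDiff (hf : HasC2Derivs f f' f'') : ContDiff ℝ 2 f := by
  rw [show (2 : WithTop ℕ∞) = 1 + 1 by norm_num, contDiff_succ_iff_deriv]
  refine ⟨fun x => (hf.fst x).differentiableAt, by simp, ?_⟩
  rw [hf.deriv_eq, contDiff_one_iff_deriv]
  refine ⟨fun x => (hf.snd x).differentiableAt, ?_⟩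
  rw [show deriv f' = f'' from funext fun x => (hf.snd x).deriv]
  exact hf.cont

end HasC2Derivs

namespace IsSol

variable {a : ℝ} {y y' : ℝ → ℝ}

lemma hasC2Derivs (h : IsSol a y y') : HasC2Derivs y y' (curv a y y') :=
  ⟨fun x => (h x).1, fun x => (h x).2, h.continuous_curv⟩

lemma hasC2Derivs_comp_div (h : IsSol a y y') (σ : ℝ) :
    HasC2Derivs (fun x => y (x / σ)) (fun x => y' (x / σ) / σ)
      (fun x => curv a y y' (x / σ) / σ ^ 2) := by
  have hd : ∀ x : ℝ, HasDerivAt (fun x : ℝ => x / σ) (1 / σ) x := fun x =>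
    (hasDerivAt_id x).div_const σ
  refine ⟨fun x => ?_, fun x => ?_, ?_⟩
  · exact (HasDerivAt.comp x (h (x / σ)).1 (hd x)).congr_deriv (by ring)
  · exact ((HasDerivAt.comp x (h (x / σ)).2 (hd x)).div_const σ).congr_deriv (by
      simp only [curv]; ring)
  · exact (h.continuous_curv.comp (continuous_id.div_const σ)).div_const _

end IsSol

/-! ### The glued solution -/

variable {σ : ℝ}

lemma mu_relations (hl : l < 1 / 2) (hp : 0 ≤ phi'' l (-(σ * zeta l)))
    (hn : phi'' l (σ * zeta l) < 0) :
    0 < mu1 l σ ∧ 0 ≤ mu2 l σ ∧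
      mu1 l σ * phi l (-(σ * zeta l)) + mu2 l σ * phi l (σ * zeta l) =
        phi l (zeta l) + phi l (-zeta l) ∧
      mu1 l σ * phi'' l (-(σ * zeta l)) + mu2 l σ * phi'' l (σ * zeta l) = 0 := by
  have hφ1 := phi_pos hl (σ * zeta l)
  have hφ2 := phi_pos hl (-(σ * zeta l))
  have hU : 0 < phi l (-zeta l) + phi l (zeta l) := add_pos (phi_pos hl _) (phi_pos hl _)
  have hD : phi l (-(σ * zeta l)) * phi'' l (σ * zeta l) -
      phi l (σ * zeta l) * phi'' l (-(σ * zeta l)) < 0 := by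
    nlinarith [mul_pos_of_neg_of_neg hn (neg_neg_of_pos hφ2), mul_nonneg hφ1.le hp]
  have hD2 : phi l (σ * zeta l) * phi'' l (-(σ * zeta l)) -
      phi l (-(σ * zeta l)) * phi'' l (σ * zeta l) =
      -(phi l (-(σ * zeta l)) * phi'' l (σ * zeta l) -
      phi l (σ * zeta l) * phi'' l (-(σ * zeta l))) := by ring
  unfold mu1 mu2
  rw [hD2, inv_neg]
  set D := phi l (-(σ * zeta l)) * phi'' l (σ * zeta l) -
      phi l (σ * zeta l) * phi'' l (-(σ * zeta l)) with hDdef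
  have hDi : D⁻¹ < 0 := inv_lt_zero.2 hD
  refine ⟨mul_pos (mul_pos_of_neg_of_neg hn hDi) hU,
    mul_nonneg (mul_nonneg hp (by linarith)) hU.le, ?_, ?_⟩
  · have hDD : D⁻¹ * D = 1 := inv_mul_cancel₀ hD.ne
    have e : phi'' l (σ * zeta l) * D⁻¹ * (phi l (-zeta l) + phi l (zeta l)) *
        phi l (-(σ * zeta l)) + phi'' l (-(σ * zeta l)) * -D⁻¹ *
        (phi l (-zeta l) + phi l (zeta l)) * phi l (σ * zeta l) =
        (phi l (-zeta l) + phi l (zeta l)) * (D⁻¹ * D) := by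
      rw [hDdef]; ring
    rw [e, hDD]; ring
  · ring

/-- For a solution of the linear equation, value and curvature determine the derivative away from
the origin. -/
lemma deriv_eq_of_curv_eq_zero {a x : ℝ} {y y' : ℝ → ℝ} (hx : x ≠ 0) (h : curv a y y' x = 0) :
    y' x = -(a * y x) / x := by
  rw [eq_div_iff hx]
  simp only [curv] at h
  linarith

lemma H_isC2Solution (hσ : 0 < σ) (h0 : 0 < l) (hl : l < 1 / 2)
    (hp : 0 ≤ phi'' l (-(σ * zeta l))) (hn : phi'' l (σ * zeta l) < 0) :
    (∀ x, 0 < H l σ x) ∧ IsC2Solution l σ (H l σ) := by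
  obtain ⟨hm1, hm2, hval, hcurv⟩ := mu_relations hl hp hn
  have ha : 0 < 2 * l := by linarith
  have hz := isZ_zeta h0 hl
  have hφ := phi_pos hl
  have hcφ := phi''_eq_curv hl
  set z := zeta l with hzdef
  set w := σ * z with hw
  set p := mu1 l σ
  set q := mu2 l σ
  have hw0 : 0 < w := mul_pos hσ hz.1
  have hwσ : w / σ = z := by rw [hw]; field_simp
  -- the left, middle and right pieces
  have hA := (isSol_phi hl).comb_reflect p q
  have hB := isSol_phi_even hl
  have hC := (isSol_phi hl).comb_reflect q p
  set A := fun x => p * phi l x + q * phi l (-x) with hAd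
  set A' := fun x => p * dphi l x - q * dphi l (-x) with hAd'
  set B := fun x => 1 * phi l x + 1 * phi l (-x) with hBd
  set B' := fun x => 1 * dphi l x - 1 * dphi l (-x) with hBd'
  set C := fun x => q * phi l x + p * phi l (-x) with hCd
  set C' := fun x => q * dphi l x - p * dphi l (-x) with hCd'
  have hcA : ∀ x, curv (2 * l) A A' x = p * phi'' l x + q * phi'' l (-x) := fun x => by
    rw [hAd, hAd', IsSol.curv_comb_reflect, hcφ, hcφ]
  have hcB : ∀ x, curv (2 * l) B B' x = phi'' l x + phi'' l (-x) := curv_phi_even hl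
  have hcC : ∀ x, curv (2 * l) C C' x = q * phi'' l x + p * phi'' l (-x) := fun x => by
    rw [hCd, hCd', IsSol.curv_comb_reflect, hcφ, hcφ]
  have hC0 : ∀ x, 0 < C x := fun x =>
    add_pos_of_nonneg_of_pos (mul_nonneg hm2 (hφ x).le) (mul_pos hm1 (hφ (-x)))
  have hA0 : ∀ x, 0 < A x := fun x =>
    add_pos_of_pos_of_nonneg (mul_pos hm1 (hφ x)) (mul_nonneg hm2 (hφ (-x)).le)
  have hB0 : ∀ x, 0 < B x := phi_even_pos hl
  -- curvatures vanish at the gluing points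
  have hAw : curv (2 * l) A A' (-w) = 0 := by rw [hcA, neg_neg]; exact hcurv
  have hCw : curv (2 * l) C C' w = 0 := by rw [hcC]; linarith
  have hBz : curv (2 * l) B B' z = 0 := by rw [hcB]; exact hz.2
  have hBz' : curv (2 * l) B B' (-z) = 0 := by rw [hcB, neg_neg, add_comm]; exact hz.2
  have hvA : A (-w) = B (-z) := by
    simp only [hAd, hBd, neg_neg]; linarith
  have hvC : B z = C w := by
    simp only [hCd, hBd]; linarith
  have hdA : A' (-w) = B' (-z) / σ := by
    rw [deriv_eq_of_curv_eq_zero (neg_ne_zero.2 hw0.ne') hAw,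
      deriv_eq_of_curv_eq_zero (neg_ne_zero.2 hz.1.ne') hBz', hvA, hw]
    have := hz.1.ne'
    field_simp
  have hdC : B' z / σ = C' w := by
    rw [deriv_eq_of_curv_eq_zero hw0.ne' hCw, deriv_eq_of_curv_eq_zero hz.1.ne' hBz, hvC, hw]
    have := hz.1.ne'
    field_simp
  have hin := (hB.hasC2Derivs_comp_div σ).glue hC.hasC2Derivs (c := w)
    (by simp only [hwσ, hvC]) (by simp only [hwσ, hdC])
    (by simp only [hwσ, hBz, hCw, zero_div])
  have hww : -w ≤ w := by linarith
  have hwσ' : -w / σ = -z := by rw [neg_div, hwσ]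
  have hall := hA.hasC2Derivs.glue hin (c := -w)
    (by simp only [hww, if_true, hwσ', hvA]) (by simp only [hww, if_true, hwσ', hdA])
    (by simp only [hww, if_true, hwσ', hBz', hAw, zero_div])
  have hH : H l σ = fun x => if x ≤ -w then A x else if x ≤ w then B (x / σ) else C x := by
    funext x
    simp only [H]
    rw [← hzdef, ← hw]
    split_ifs with h1 h2 h3 h3
    · rfl
    · simp only [hBd, one_mul]
    · exact absurd h2.le h3
    · rw [show x = w from le_antisymm h3 (not_lt.1 h2), hwσ, hvC]
    · rfl
  rw [hH]
  refine ⟨fun x => ?_, hall.contDiff, fun x => ?_⟩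
  · dsimp only
    split_ifs
    exacts [hA0 x, hB0 _, hC0 x]
  rw [hall.deriv_deriv_eq, hall.deriv_eq]
  dsimp only
  -- beyond `w` the curvature is nonnegative, as it vanishes at `w`
  have hCpos : ∀ x, w ≤ x → 0 ≤ curv (2 * l) C C' x := by
    intro x hx
    rcases hx.eq_or_lt with rfl | hlt
    · exact hCw.ge
    · exact (hC.curv_pos_of_lt ha (fun t _ => hC0 t) hw0 hlt hCw.ge).le
  split_ifs with h1 h2
  · have hc : 0 ≤ curv (2 * l) A A' x := by
      have := hCpos (-x) (by linarith)
      rw [hcC, neg_neg] at this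
      rw [hcA]
      linarith
    rw [max_eq_left hc, max_eq_right (neg_nonpos.2 hc)]
    simp only [curv]
    ring
  · have hc : curv (2 * l) B B' (x / σ) ≤ 0 := by
      have hle : ∀ t, 0 < t → t ≤ z → phi'' l t + phi'' l (-t) ≤ 0 := fun t ht htz => by
        rcases htz.eq_or_lt with rfl | hlt
        · exact hz.2.le
        · exact ((phi''_even_neg_iff h0 hl ht).2 hlt).le
      rw [hcB]
      have hx1 : x / σ ≤ z := by rw [← hwσ]; exact div_le_div_of_nonneg_right h2 hσ.le
      have hx2 : -z ≤ x / σ := by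
        rw [← hwσ']; exact div_le_div_of_nonneg_right (not_le.1 h1).le hσ.le
      rcases lt_trichotomy (x / σ) 0 with h | h | h
      · have := hle (-(x / σ)) (by linarith) (by linarith)
        rw [neg_neg] at this
        linarith
      · rw [h, neg_zero]
        linarith [phi''_zero_neg h0 hl]
      · exact hle _ h hx1
    have hc' : curv (2 * l) B B' (x / σ) / σ ^ 2 ≤ 0 :=
      div_nonpos_of_nonpos_of_nonneg hc (sq_nonneg σ)
    rw [max_eq_right hc', max_eq_left (neg_nonneg.2 hc')]
    simp only [curv]
    field_simp
    ring
  · have hc := hCpos x (not_le.1 h2).le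
    rw [max_eq_left hc, max_eq_right (neg_nonpos.2 hc)]
    simp only [curv]
    ring

/-- For `l ≤ lambdaOf σ`, monotonicity of `sigmaOf` puts the gluing point `σ * zeta l` between
`-x1 l` and `zeta l`. -/
lemma phi''_signs_of_le_lambdaOf (hσ : 0 < σ) (hσ1 : σ < 1) (h0 : 0 < l)
    (hle : l ≤ lambdaOf σ) :
    l < 1 / 2 ∧ 0 ≤ phi'' l (-(σ * zeta l)) ∧ phi'' l (σ * zeta l) < 0 := by
  obtain ⟨hI, hs⟩ := isLambda_lambdaOf hσ hσ1
  have hl : l < 1 / 2 := hle.trans_lt hI.2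
  have hz := zeta_pos h0 hl
  have hw : 0 < σ * zeta l := mul_pos hσ hz
  have hmono : sigmaOf l ≤ σ := by
    have h := strictMonoOn_sigmaOf.monotoneOn (show l ∈ Set.Ioo (0 : ℝ) (1 / 2) from ⟨h0, hl⟩)
      hI hle
    rwa [hs] at h
  rw [sigmaOf, div_le_iff₀ hz] at hmono
  have h1 : 0 ≤ phi'' l (-(σ * zeta l)) :=
    not_lt.1 fun h => absurd ((phi''_neg_neg_iff h0 hl hw).1 h) (not_lt.2 hmono)
  have h2 := (phi''_even_neg_iff h0 hl hw).2 (by nlinarith)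
  exact ⟨hl, h1, by linarith⟩

end GHeat

theorem theorem2112 (σ : ℝ) (hσ : σ ∈ Set.Ioo (0 : ℝ) 1) :
    -- the constants in the definitions of `H` and `lambdaOf` exist and are unique
    (∀ l ∈ Set.Ioo (0 : ℝ) (1 / 2), (∃! x : ℝ, GHeat.IsX1 l x) ∧ (∃! z : ℝ, GHeat.IsZ l z)) ∧
    (∃! l : ℝ, GHeat.IsLambda σ l) ∧
    -- the function `H` is a positive solution
    ∀ l ∈ Set.Ioc (0 : ℝ) (GHeat.lambdaOf σ),
      0 < GHeat.mu1 l σ ∧ 0 ≤ GHeat.mu2 l σ ∧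
      (∀ x : ℝ, 0 < GHeat.H l σ x) ∧ GHeat.IsC2Solution l σ (GHeat.H l σ) := by
  refine ⟨fun l hl => ⟨GHeat.existsUnique_isX1 hl.1 hl.2, GHeat.existsUnique_isZ hl.1 hl.2⟩,
    GHeat.existsUnique_isLambda hσ.1 hσ.2, fun l hl => ?_⟩
  obtain ⟨hl2, hp, hn⟩ := GHeat.phi''_signs_of_le_lambdaOf hσ.1 hσ.2 hl.1 hl.2
  obtain ⟨hm1, hm2, -, -⟩ := GHeat.mu_relations hl2 hp hn
  exact ⟨hm1, hm2, GHeat.H_isC2Solution hσ.1 hl.1 hl2 hp hn⟩
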